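/- Let $(X,dx)$ be a $\sigma$-finite measure space on which a compact group $G$ acts measurably and measure-preservingly, and let $dg$ be the (two-sided) invariant probability measure on $G$. Let $\nabla$ be a weak differentiation operator on $X$: a closed linear operator from a subspace $\mathrm{dom}\,\nabla\subseteq L^2(X;\mathbb C)$ to $L^2(X;\mathbb C^{n})$ satisfying the chain rule $\varphi\circ u\in\mathrm{dom}\,\nabla$, $\nabla(\varphi\circ u)=d\varphi(u)\cdot\nabla u$ for $u\in\mathrm{dom}\,\nabla$ and every (real-)$C^1$ function $\varphi:\mathbb C\to\mathbb C$ with bounded differential and $\varphi(0)=0$. Assume that the action of $G$ preserves $\mathrm{dom}\,\nabla$ and $T[u]:=\int_X|\nabla u|^2$ (for example, $G$ acts by isometries). Let $V:X\to\mathbb R$ and $h:X\times X\to\mathbb R$ be measurable with $V(g.x)=V(x)$ and $h(g.x,g.y)=h(x,y)$ for all $g\in G$. Let $\mathcal I\subseteq L^1(X;\mathbb R)$ be a linear space such that for every $f\in\mathcal I$ the integral $$Q[f]=\int_X\int_X f(x)\,h(x,y)\,f(y)\,dx\,dy$$ converges absolutely and the mean $x\mapsto\int_G f(g.x)\,dg$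 is again in $\mathcal I$. Assume that $h$ is positive-definite on the functions of integral zero: $Q[f]>0$ for every nonzero $f\in\mathcal I$ with $\int_X f=0$. Let $b>0$ and $$E[u]=\int_X|\nabla u|^2+\int_X V|u|^2+b\,Q[|u|^2]$$ on the set $\mathcal X$ of all $u\in\mathrm{dom}\,\nabla$ with $V|u|^2\in L^1$ and $|u|^2\in\mathcal I$. If $u\in\mathcal X$ is a ground state with $\|u\|_2^2=N$, that is, $E[u]\le E[v]$ for all $v\in\mathcal X$ with $\|v\|_2^2=N$, then $|u|$ is $G$-invariant: for every $g\in G$, $|u(g.x)|=|u(x)|$ for almost every $x$. In particular, if $u$ is nonnegative, or more generally $u=c\,|u|$ almost everywhere for a constant $c$, then for every $g\in G$, $u(g.x)=u(x)$ for almost every $x$. -/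

import Mathlib

open MeasureTheory

noncomputable section

/-- A weak differentiation operator `u ↦ ∇u` on a measure space `X`, with `∇u(x) ∈ ℂ^ι`: a closed
linear operator from a subspace of `L²(X; ℂ)` to `L²(X; ℂ^ι)` (so its domain is complete in the
norm `(‖u‖² + ‖∇u‖²)^(1/2)`), obeying the chain rule `∇(φ ∘ u) = dφ(u) · ∇u` for all functions
`φ : ℂ → ℂ` that are real-`C¹` with bounded differential and fix `0`.
Typical examples are the weak gradients on `H¹(ℝᵈ)`, on `H₀¹(Ω)` and on `H¹` of a manifold. -/
structure WeakGradient {X : Type*} [MeasurableSpace X] (μ : Measure X)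
    (ι : Type*) [Fintype ι] where
  grad : Lp ℂ 2 μ →ₗ.[ℂ] Lp (EuclideanSpace ℂ ι) 2 μ
  closed : grad.IsClosed
  chain_rule : ∀ (φ : ℂ → ℂ) (C : ℝ), ContDiff ℝ 1 φ → φ 0 = 0 →
    (∀ z, ‖fderiv ℝ φ z‖ ≤ C) → ∀ u : grad.domain, ∃ w : grad.domain,
      (∀ᵐ x ∂μ, (w : Lp ℂ 2 μ) x = φ ((u : Lp ℂ 2 μ) x)) ∧
      (∀ᵐ x ∂μ, ∀ i, grad w x i = fderiv ℝ φ ((u : Lp ℂ 2 μ) x) (grad u x i))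

section Energy

variable {X : Type*} [MeasurableSpace X] {μ : Measure X} {ι : Type*} [Fintype ι]

/-- The density `|u|²`. -/
def density (u : Lp ℂ 2 μ) : X → ℝ := fun x => ‖u x‖ ^ 2

/-- The kinetic energy `T[u] = ∫ |∇u|²`. -/
def kinetic (D : WeakGradient μ ι) (u : D.grad.domain) : ℝ :=
  ∫ x, ‖D.grad u x‖ ^ 2 ∂μ

/-- The external potential energy `P[f] = ∫ V f`. -/
def potential (μ : Measure X) (V : X → ℝ) (f : X → ℝ) : ℝ :=
  ∫ x, V x * f x ∂μ

/-- The self-interaction energy `Q[f] = ∫∫ f(x) h(x,y) f(y) dx dy`. -/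
def interaction (μ : Measure X) (h : X → X → ℝ) (f : X → ℝ) : ℝ :=
  ∫ p : X × X, f p.1 * h p.1 p.2 * f p.2 ∂(μ.prod μ)

/-- (Absolute) convergence of the integral that defines `Q[f]`. -/
def InteractionConverges (μ : Measure X) (h : X → X → ℝ) (f : X → ℝ) : Prop :=
  Integrable (fun p : X × X => f p.1 * h p.1 p.2 * f p.2) (μ.prod μ)

/-- `E[u] = T[u] + P[|u|²] + b Q[|u|²]`. -/
def energy (D : WeakGradient μ ι) (V : X → ℝ) (h : X → X → ℝ) (b : ℝ)
    (u : D.grad.domain) : ℝ :=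
  kinetic D u + potential μ V (density (u : Lp ℂ 2 μ))
    + b * interaction μ h (density (u : Lp ℂ 2 μ))

/-- The functions on which `E` is considered: `u` is weakly differentiable, `V |u|²` is integrable,
and `|u|²` belongs to the given linear space `I` of integrable functions. -/
def energySpace (D : WeakGradient μ ι) (V : X → ℝ) (I : Submodule ℝ (Lp ℝ 1 μ)) :
    Set D.grad.domain :=
  {u | Integrable (fun x => V x * density (u : Lp ℂ 2 μ) x) μ ∧
    ∃ f ∈ I, f =ᵐ[μ] density (u : Lp ℂ 2 μ)}

/-- `u` is a ground state of `E` subject to the constraint `‖u‖₂² = N`. -/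
def IsGroundState (D : WeakGradient μ ι) (V : X → ℝ) (h : X → X → ℝ) (b : ℝ)
    (I : Submodule ℝ (Lp ℝ 1 μ)) (N : ℝ) (u : D.grad.domain) : Prop :=
  u ∈ {v ∈ energySpace D V I | ‖(v : Lp ℂ 2 μ)‖ ^ 2 = N} ∧
    IsMinOn (energy D V h b) {v ∈ energySpace D V I | ‖(v : Lp ℂ 2 μ)‖ ^ 2 = N} u

/-- `h` is positive-definite on the functions in `I` with integral zero. -/
def IsPosDefOnMeanZero (h : X → X → ℝ) (I : Submodule ℝ (Lp ℝ 1 μ)) : Prop :=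
  ∀ f ∈ I, ∫ x, f x ∂μ = 0 → f ≠ 0 → 0 < interaction μ h f

variable (G : Type*) [Group G] [MulAction G X]

/-- The group action preserves the domain of `∇` and the kinetic energy. -/
def KineticInvariant (D : WeakGradient μ ι) : Prop :=
  ∀ (g : G) (u : D.grad.domain), ∃ w : D.grad.domain,
    (∀ᵐ x ∂μ, (w : Lp ℂ 2 μ) x = (u : Lp ℂ 2 μ) (g • x)) ∧ kinetic D w = kinetic D u

variable {G}

/-- `I` contains with `f` also its mean over the group, `x ↦ ∫_G f(g.x) dg`. -/
def MeanStable [MeasurableSpace G] (ν : Measure G) (I : Submodule ℝ (Lp ℝ 1 μ)) : Prop :=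
  ∀ f ∈ I, ∃ F ∈ I, F =ᵐ[μ] fun x => ∫ g : G, f (g • x) ∂ν

end Energy

end

/-! Let `f = |u|²` and let `F` be its mean over the group. The trial function `√F` has the same norm
and the same potential energy as `u`. By invariance of `h` and `F`, both cross terms of `Q[f - F]`
equal `Q[F]`, so `Q[f] - Q[F] = Q[f - F]`, which is positive unless `f = F` almost everywhere
(`interaction_sub_groupMean`). Hence `√F` would beat `u` as soon as its kinetic energy is not
larger.

That is convexity of `T` in the density. For real functions `√(a² + b²) = |a + ib|`, so the
diamagnetic inequality `T[|u|] ≤ T[u]` gives the bound for finite averages of translates of `f`. By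
the strong law of large numbers, such averages along a suitable sequence of group elements tend to
`F` almost everywhere, and lower semicontinuity of `T` (`exists_kinetic_le_of_approx`) passes to the
limit. -/

section

/-! ### Convergence criteria in Hilbert spaces -/

open Filter Topology

/-- A nonincreasing sequence of nonempty, uniformly bounded convex sets in an inner product space
admits a Cauchy sequence of selections. -/
theorem exists_cauchySeq_selection_of_convex {K : Type*} [NormedAddCommGroup K]
    [InnerProductSpace ℝ K] (S : ℕ → Set K) (hS : Antitone S) (hne : ∀ n, (S n).Nonempty)
    (hconv : ∀ n, Convex ℝ (S n)) {M : ℝ} (hM : ∀ n, ∀ y ∈ S n, ‖y‖ ^ 2 ≤ M) :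
    ∃ y : ℕ → K, (∀ n, y n ∈ S n) ∧ CauchySeq y := by
  let d : ℕ → ℝ := fun n => sInf ((fun y : K => ‖y‖ ^ 2) '' S n)
  have hbdd : ∀ n, BddBelow ((fun y : K => ‖y‖ ^ 2) '' S n) := fun n =>
    ⟨0, by rintro _ ⟨y, -, rfl⟩; positivity⟩
  have hd_le : ∀ n, ∀ y ∈ S n, d n ≤ ‖y‖ ^ 2 := fun n y hy =>
    csInf_le (hbdd n) ⟨y, hy, rfl⟩
  have hd_mono : Monotone d := fun m n hmn =>
    csInf_le_csInf (hbdd m) ((hne n).image _) (Set.image_mono (hS hmn))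
  have hd_bdd : BddAbove (Set.range d) := by
    refine ⟨M, ?_⟩
    rintro _ ⟨n, rfl⟩
    obtain ⟨y, hy⟩ := hne n
    exact (hd_le n y hy).trans (hM n y hy)
  have hd_lim : Tendsto d atTop (𝓝 (⨆ n, d n)) := tendsto_atTop_ciSup hd_mono hd_bdd
  have hsel : ∀ n : ℕ, ∃ y ∈ S n, ‖y‖ ^ 2 < d n + 1 / ((n : ℝ) + 1) := by
    intro n
    obtain ⟨_, ⟨y, hy, rfl⟩, hlt⟩ := exists_lt_of_csInf_lt ((hne n).image fun y : K => ‖y‖ ^ 2)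
      (lt_add_of_pos_right (d n) (Nat.one_div_pos_of_nat (n := n)))
    exact ⟨y, hy, hlt⟩
  choose y hyS hy using hsel
  refine ⟨y, hyS, ?_⟩
  -- The midpoint of `y n` and `y m` lies in `S n`, so for `n ≤ m` the parallelogram law bounds `‖y
  -- n - y m‖²` by `2 (d m - d n) + 4 / (n + 1)`, and `e n` dominates this.
  let s := ⨆ n, d n
  let e : ℕ → ℝ := fun n => 4 * (s - d n) + 4 * (1 / ((n : ℝ) + 1))
  have he : Tendsto e atTop (𝓝 0) := by
    have h1 := ((tendsto_const_nhds (x := s)).sub hd_lim).const_mul 4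
    have h2 := (tendsto_one_div_add_atTop_nhds_zero_nat (𝕜 := ℝ)).const_mul 4
    simpa [s, e] using h1.add h2
  have hkey : ∀ n m, n ≤ m → ‖y n - y m‖ ^ 2 ≤ e n := by
    intro n m hnm
    have hmid : (1 / 2 : ℝ) • y n + (1 / 2 : ℝ) • y m ∈ S n :=
      hconv n (hyS n) (hS hnm (hyS m)) (by norm_num) (by norm_num) (by norm_num)
    have h1 := hd_le n _ hmid
    rw [← smul_add, norm_smul, mul_pow] at h1
    have h2 := parallelogram_law_with_norm ℝ (y n) (y m)
    have h3 : (1 : ℝ) / ((m : ℝ) + 1) ≤ 1 / ((n : ℝ) + 1) := by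
      have : (n : ℝ) ≤ m := by exact_mod_cast hnm
      gcongr
    have h4 : d m ≤ s := le_ciSup hd_bdd m
    have h5 : d n ≤ s := le_ciSup hd_bdd n
    have h6 := hy n
    have h7 := hy m
    norm_num at h1
    simp only [e]
    nlinarith
  have he' : Tendsto (fun n => 2 * Real.sqrt (e n)) atTop (𝓝 0) := by
    simpa using (he.sqrt).const_mul 2
  refine cauchySeq_of_le_tendsto_0 _ (fun n m N hn hm => ?_) he'
  have h1 := Real.le_sqrt_of_sq_le (hkey N n hn)
  have h2 := Real.le_sqrt_of_sq_le (hkey N m hm)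
  rw [← dist_eq_norm] at h1 h2
  have := dist_triangle_left (y n) (y m) (y N)
  linarith

/-- Almost everywhere convergence in `L²` without increase of the norm is convergence in norm. -/
theorem tendsto_Lp_two_of_ae_tendsto_of_norm_le {X : Type*} [MeasurableSpace X] {μ : Measure X}
    (v : ℕ → Lp ℂ 2 μ) (w : Lp ℂ 2 μ)
    (hlim : ∀ᵐ x ∂μ, Tendsto (fun n => v n x) atTop (𝓝 (w x)))
    (hnorm : ∀ n, ‖v n‖ ≤ ‖w‖) : Tendsto v atTop (𝓝 w) := by
  have hae : ∀ᵐ x ∂μ, Tendsto (fun n => (v n + w) x) atTop (𝓝 ((w + w) x)) := by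
    filter_upwards [hlim, ae_all_iff.2 fun n => Lp.coeFn_add (v n) w, Lp.coeFn_add w w]
      with x hx h1 h2
    simp only [h1, h2, Pi.add_apply]
    exact hx.add_const _
  -- Fatou for `v n + w` forces `‖v n + w‖ → 2‖w‖`; the parallelogram law then forces `‖v n - w‖ →
  -- 0`.
  have hfatou := Lp.eLpNorm_lim_le_liminf_eLpNorm (p := 2)
    (fun n => Lp.aestronglyMeasurable (v n + w)) _ hae
  have hww : ‖w + w‖ = 2 * ‖w‖ := by rw [← two_smul ℝ w, norm_smul]; norm_num
  have hsum : Tendsto (fun n => ‖v n + w‖) atTop (𝓝 (2 * ‖w‖)) := by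
    refine tendsto_order.2 ⟨fun a ha => ?_, fun a ha => Eventually.of_forall fun n => ?_⟩
    · rcases lt_or_ge a 0 with ha0 | ha0
      · exact Eventually.of_forall fun n => ha0.trans_le (norm_nonneg _)
      have hlt : ENNReal.ofReal a < liminf (fun n => eLpNorm (v n + w : Lp ℂ 2 μ) 2 μ) atTop := by
        refine lt_of_lt_of_le ?_ hfatou
        rw [← Lp.enorm_def, ← ofReal_norm, hww]
        exact (ENNReal.ofReal_lt_ofReal_iff (ha0.trans_lt ha)).2 ha
      filter_upwards [eventually_lt_of_lt_liminf hlt] with n hn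
      rw [← Lp.enorm_def, ← ofReal_norm] at hn
      exact lt_of_not_ge fun hle => absurd hn (not_lt.2 (ENNReal.ofReal_le_ofReal hle))
    · have := norm_add_le (v n) w
      have := hnorm n
      linarith
  rw [tendsto_iff_norm_sub_tendsto_zero]
  have hsq : Tendsto (fun n => Real.sqrt (4 * ‖w‖ ^ 2 - ‖v n + w‖ ^ 2)) atTop (𝓝 0) := by
    have := ((tendsto_const_nhds (x := 4 * ‖w‖ ^ 2)).sub (hsum.pow 2)).sqrt
    convert this using 2
    rw [show 4 * ‖w‖ ^ 2 - (2 * ‖w‖) ^ 2 = 0 by ring, Real.sqrt_zero]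
  refine squeeze_zero (fun n => norm_nonneg _) (fun n => Real.le_sqrt_of_sq_le ?_) hsq
  have h1 := parallelogram_law_with_norm ℂ (v n) w
  have h2 := mul_self_le_mul_self (norm_nonneg _) (hnorm n)
  nlinarith

/-- The square of the `L²` norm as an integral. -/
theorem norm_sq_eq_integral_norm_sq {X : Type*} [MeasurableSpace X] {μ : Measure X} {E : Type*}
    [NormedAddCommGroup E] [InnerProductSpace ℂ E] (v : Lp E 2 μ) :
    ‖v‖ ^ 2 = ∫ x, ‖v x‖ ^ 2 ∂μ := by
  have h1 : (inner ℂ v v : ℂ) = ∫ x, ((‖v x‖ ^ 2 : ℝ) : ℂ) ∂μ := by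
    rw [L2.inner_def]
    simp_rw [inner_self_eq_norm_sq_to_K]
    simp
  rw [inner_self_eq_norm_sq_to_K, integral_complex_ofReal] at h1
  refine Complex.ofReal_injective (Eq.trans ?_ h1)
  norm_cast

/-! ### Lower semicontinuity of the kinetic energy -/

section

variable {X : Type*} [MeasurableSpace X] {μ : Measure X} {ι : Type*} [Fintype ι]
  (D : WeakGradient μ ι)

theorem kinetic_eq_norm_sq (u : D.grad.domain) : kinetic D u = ‖D.grad u‖ ^ 2 :=
  (norm_sq_eq_integral_norm_sq _).symm

theorem kinetic_mono_of_ae_le {u w : D.grad.domain}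
    (h : ∀ᵐ x ∂μ, ∀ i, ‖D.grad w x i‖ ≤ ‖D.grad u x i‖) : kinetic D w ≤ kinetic D u := by
  refine integral_mono_ae ((Lp.memLp (D.grad w)).integrable_norm_pow two_ne_zero)
    ((Lp.memLp (D.grad u)).integrable_norm_pow two_ne_zero) ?_
  filter_upwards [h] with x hx
  simp only [EuclideanSpace.norm_sq_eq]
  gcongr with i
  exact hx i

/-- The sublevel sets of the kinetic energy are closed in `L²`. -/
theorem exists_kinetic_le_of_approx (v : Lp ℂ 2 μ) (M : ℝ)
    (h : ∀ ε > 0, ∃ w : D.grad.domain, ‖(w : Lp ℂ 2 μ) - v‖ ≤ ε ∧ kinetic D w ≤ M) :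
    ∃ w : D.grad.domain, (w : Lp ℂ 2 μ) = v ∧ kinetic D w ≤ M := by
  -- Gradients of approximants of `v` are bounded but need not converge. Since `D.grad` is linear,
  -- the sets `S n` are convex, so a Cauchy selection exists and closedness of the graph applies to
  -- its limit.
  let S : ℕ → Set (Lp (EuclideanSpace ℂ ι) 2 μ) := fun n =>
    {y | ∃ w : D.grad.domain, D.grad w = y ∧ ‖(w : Lp ℂ 2 μ) - v‖ ≤ 1 / ((n : ℝ) + 1) ∧
      ‖y‖ ≤ √M}
  have hM : 0 ≤ M := by
    obtain ⟨w, -, hw⟩ := h 1 one_pos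
    rw [kinetic_eq_norm_sq] at hw
    exact (sq_nonneg _).trans hw
  obtain ⟨y, hyS, hy⟩ := exists_cauchySeq_selection_of_convex (M := M) S
    (by
      rintro m n hmn y ⟨w, h1, h2, h3⟩
      refine ⟨w, h1, h2.trans ?_, h3⟩
      have : (m : ℝ) ≤ n := by exact_mod_cast hmn
      gcongr)
    (by
      intro n
      obtain ⟨w, h1, h2⟩ := h _ (Nat.one_div_pos_of_nat (n := n))
      rw [kinetic_eq_norm_sq] at h2
      exact ⟨_, w, rfl, h1, Real.le_sqrt_of_sq_le h2⟩)
    (by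
      rintro n _ ⟨w, rfl, h2, h3⟩ _ ⟨w', rfl, h2', h3'⟩ a b ha hb hab
      refine ⟨(a : ℂ) • w + (b : ℂ) • w', ?_, ?_, ?_⟩
      · rw [D.grad.map_add, D.grad.map_smul, D.grad.map_smul]
        rfl
      · have := (convex_closedBall v (1 / ((n : ℝ) + 1))) (mem_closedBall_iff_norm.2 h2)
          (mem_closedBall_iff_norm.2 h2') ha hb hab
        exact mem_closedBall_iff_norm.1 this
      · have := (convex_closedBall (0 : Lp (EuclideanSpace ℂ ι) 2 μ) (√M))
          (mem_closedBall_zero_iff.2 h3) (mem_closedBall_zero_iff.2 h3') ha hb hab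
        exact mem_closedBall_zero_iff.1 this)
    (by
      rintro n y ⟨-, -, -, h3⟩
      exact (Real.le_sqrt (norm_nonneg _) hM).1 h3)
  obtain ⟨z, hz⟩ := cauchySeq_tendsto_of_complete hy
  choose w hw1 hw2 hw3 using hyS
  have hwv : Tendsto (fun n => (w n : Lp ℂ 2 μ)) atTop (𝓝 v) :=
    tendsto_iff_norm_sub_tendsto_zero.2
      (squeeze_zero (fun _ => norm_nonneg _) hw2 tendsto_one_div_add_atTop_nhds_zero_nat)
  have hmem : (v, z) ∈ D.grad.graph :=
    D.closed.mem_of_tendsto (hwv.prodMk_nhds hz)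
      (Eventually.of_forall fun n => (LinearPMap.mem_graph_iff _).2 ⟨w n, rfl, hw1 n⟩)
  obtain ⟨w', h1, h2⟩ := (LinearPMap.mem_graph_iff _).1 hmem
  refine ⟨w', h1, ?_⟩
  rw [kinetic_eq_norm_sq, h2]
  exact (Real.le_sqrt (norm_nonneg _) hM).1
    (le_of_tendsto hz.norm (Eventually.of_forall hw3))

end

/-! ### Smooth approximation of the modulus -/

/-- The regularized modulus `z ↦ √(|z|² + ε²) - ε`. -/
noncomputable def smoothModulus (ε : ℝ) (z : ℂ) : ℂ := ((√(‖z‖ ^ 2 + ε ^ 2) - ε : ℝ) : ℂ)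

theorem smoothModulus_zero {ε : ℝ} (hε : 0 < ε) : smoothModulus ε 0 = 0 := by
  simp [smoothModulus, Real.sqrt_sq hε.le]

theorem contDiff_smoothModulus {ε : ℝ} (hε : 0 < ε) : ContDiff ℝ 1 (smoothModulus ε) := by
  refine Complex.ofRealCLM.contDiff.comp (((ContDiff.sqrt ?_ fun z => ?_)).sub contDiff_const)
  · exact (contDiff_norm_sq ℝ).add contDiff_const
  · positivity

/-- Both `t ↦ √(t² + ε²)` on `t ≥ 0` and the modulus are 1-Lipschitz. The bound `1`, uniform in `ε`,
is what keeps the kinetic energy from growing. -/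
theorem norm_fderiv_smoothModulus_le {ε : ℝ} (hε : 0 < ε) (z : ℂ) :
    ‖fderiv ℝ (smoothModulus ε) z‖ ≤ 1 := by
  have key : ∀ a b : ℝ, 0 ≤ a → 0 ≤ b →
      √(a ^ 2 + ε ^ 2) - √(b ^ 2 + ε ^ 2) ≤ |a - b| := by
    intro a b ha hb
    rw [sub_le_iff_le_add, Real.sqrt_le_left (by positivity)]
    have h1 : b ≤ √(b ^ 2 + ε ^ 2) := Real.le_sqrt_of_sq_le (by nlinarith)
    have h2 := Real.sq_sqrt (show 0 ≤ b ^ 2 + ε ^ 2 by positivity)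
    have h3 := sq_abs (a - b)
    have h4 := le_abs_self (a - b)
    have h5 := mul_le_mul_of_nonneg_left h1 (abs_nonneg (a - b))
    have h6 := mul_le_mul_of_nonneg_right h4 hb
    nlinarith
  have hlip : LipschitzWith 1 (smoothModulus ε) := by
    refine LipschitzWith.mk_one fun z w => ?_
    rw [dist_eq_norm, dist_eq_norm, smoothModulus, smoothModulus, ← Complex.ofReal_sub,
      Complex.norm_real, Real.norm_eq_abs]
    refine le_trans (abs_le.2 ⟨?_, ?_⟩) (abs_norm_sub_norm_le z w)
    · have := key ‖w‖ ‖z‖ (norm_nonneg _) (norm_nonneg _)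
      rw [abs_sub_comm]
      linarith
    · have := key ‖z‖ ‖w‖ (norm_nonneg _) (norm_nonneg _)
      linarith
  simpa using norm_fderiv_le_of_lipschitz ℝ hlip

theorem norm_smoothModulus_le {ε : ℝ} (hε : 0 < ε) (z : ℂ) : ‖smoothModulus ε z‖ ≤ ‖z‖ := by
  rw [smoothModulus, Complex.norm_real, Real.norm_eq_abs, abs_le]
  have h1 : √(‖z‖ ^ 2 + ε ^ 2) ≤ ‖z‖ + ε := by
    rw [Real.sqrt_le_left (by positivity)]
    nlinarith [norm_nonneg z]
  have h2 : ε ≤ √(‖z‖ ^ 2 + ε ^ 2) := Real.le_sqrt_of_sq_le (by nlinarith [norm_nonneg z])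
  constructor <;> linarith [norm_nonneg z]

theorem tendsto_smoothModulus {ε : ℕ → ℝ} (hε : Tendsto ε atTop (𝓝 0)) (z : ℂ) :
    Tendsto (fun n => smoothModulus (ε n) z) atTop (𝓝 (‖z‖ : ℂ)) := by
  have h := (((hε.pow 2).const_add (‖z‖ ^ 2)).sqrt).sub hε
  have h2 := (Complex.continuous_ofReal.tendsto _).comp h
  simpa [smoothModulus, Function.comp_def] using h2

/-! ### Diamagnetic inequality and convexity in the density -/

section

variable {X : Type*} [MeasurableSpace X] {μ : Measure X} {ι : Type*} [Fintype ι]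
  (D : WeakGradient μ ι)

/-- The diamagnetic inequality: the modulus does not increase the kinetic energy. -/
theorem exists_modulus_kinetic_le (u : D.grad.domain) :
    ∃ w : D.grad.domain, (∀ᵐ x ∂μ, (w : Lp ℂ 2 μ) x = (‖(u : Lp ℂ 2 μ) x‖ : ℂ)) ∧
      kinetic D w ≤ kinetic D u := by
  have hmem : MemLp (fun x => ((‖(u : Lp ℂ 2 μ) x‖ : ℝ) : ℂ)) 2 μ :=
    (Lp.memLp (u : Lp ℂ 2 μ)).norm.ofReal
  let v : Lp ℂ 2 μ := hmem.toLp
  have hv : ∀ᵐ x ∂μ, v x = (‖(u : Lp ℂ 2 μ) x‖ : ℂ) := hmem.coeFn_toLp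
  have hε : ∀ n : ℕ, (0 : ℝ) < 1 / ((n : ℝ) + 1) := fun n => Nat.one_div_pos_of_nat
  choose w hw hgrad using fun n : ℕ => D.chain_rule (smoothModulus (1 / ((n : ℝ) + 1))) 1
    (contDiff_smoothModulus (hε n)) (smoothModulus_zero (hε n))
    (norm_fderiv_smoothModulus_le (hε n)) u
  have hkin : ∀ n, kinetic D (w n) ≤ kinetic D u := by
    intro n
    refine kinetic_mono_of_ae_le D ?_
    filter_upwards [hgrad n] with x hx i
    rw [hx i]
    exact ((fderiv ℝ _ _).le_opNorm _).trans
      (mul_le_of_le_one_left (norm_nonneg _) (norm_fderiv_smoothModulus_le (hε n) _))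
  have hlim : Tendsto (fun n => (w n : Lp ℂ 2 μ)) atTop (𝓝 v) := by
    refine tendsto_Lp_two_of_ae_tendsto_of_norm_le _ _ ?_ fun n => ?_
    · filter_upwards [ae_all_iff.2 hw, hv] with x hx hvx
      simp only [hx, hvx]
      exact tendsto_smoothModulus tendsto_one_div_add_atTop_nhds_zero_nat _
    · refine Lp.norm_le_norm_of_ae_le ?_
      filter_upwards [hw n, hv] with x hx hvx
      rw [hx, hvx, Complex.norm_real, norm_norm]
      exact norm_smoothModulus_le (hε n) _
  obtain ⟨w', hw', hk⟩ := exists_kinetic_le_of_approx D v (kinetic D u) fun ε hε => by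
    obtain ⟨n, hn⟩ := ((tendsto_iff_norm_sub_tendsto_zero.1 hlim).eventually_le_const hε).exists
    exact ⟨w n, hn, hkin n⟩
  exact ⟨w', by rw [hw']; exact hv, hk⟩

/-- The gradient of a real-valued function is real. -/
theorem grad_im_eq_zero (u : D.grad.domain) (hu : ∀ᵐ x ∂μ, ((u : Lp ℂ 2 μ) x).im = 0) :
    ∀ᵐ x ∂μ, ∀ i, (D.grad u x i).im = 0 := by
  -- With `φ` the real part, `φ ∘ u = u`, so the chain rule says that the gradient equals its own
  -- real part.
  let φ : ℂ →L[ℝ] ℂ := Complex.ofRealCLM.comp Complex.reCLM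
  obtain ⟨w, hw, hgrad⟩ := D.chain_rule φ ‖φ‖ φ.contDiff (map_zero φ)
    (fun z => by rw [φ.fderiv]) u
  have hwu : w = u := by
    refine Subtype.ext (Lp.ext ?_)
    filter_upwards [hw, hu] with x hx hux
    rw [hx]
    apply Complex.ext <;> simp [φ, hux]
  rw [hwu] at hgrad
  filter_upwards [hgrad] with x hx i
  rw [hx i, φ.fderiv]
  simp [φ]

/-- The function sought is `|u + iv|`. As `∇u` and `∇v` are real, `|∇(u + iv)|² = |∇u|² + |∇v|²`,
and the diamagnetic inequality applies. -/
theorem exists_sqrt_add_kinetic_le (u v : D.grad.domain)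
    (hu : ∀ᵐ x ∂μ, ((u : Lp ℂ 2 μ) x).im = 0) (hv : ∀ᵐ x ∂μ, ((v : Lp ℂ 2 μ) x).im = 0) :
    ∃ w : D.grad.domain,
      (∀ᵐ x ∂μ, (w : Lp ℂ 2 μ) x =
        (√(‖(u : Lp ℂ 2 μ) x‖ ^ 2 + ‖(v : Lp ℂ 2 μ) x‖ ^ 2) : ℂ)) ∧
      kinetic D w ≤ kinetic D u + kinetic D v := by
  have hnorm : ∀ a b : ℂ, a.im = 0 → b.im = 0 →
      ‖a + Complex.I * b‖ ^ 2 = ‖a‖ ^ 2 + ‖b‖ ^ 2 := by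
    intro a b ha hb
    simp only [Complex.sq_norm, Complex.normSq_apply, ha, hb]
    simp [ha, hb]
  obtain ⟨w, hw, hk⟩ := exists_modulus_kinetic_le D (u + Complex.I • v)
  refine ⟨w, ?_, hk.trans_eq ?_⟩
  · filter_upwards [hw, hu, hv, Lp.coeFn_add (u : Lp ℂ 2 μ) (Complex.I • (v : Lp ℂ 2 μ)),
      Lp.coeFn_smul Complex.I (v : Lp ℂ 2 μ)] with x hx hux hvx h1 h2
    have h3 : ((u + Complex.I • v : D.grad.domain) : Lp ℂ 2 μ) x
        = (u : Lp ℂ 2 μ) x + Complex.I * (v : Lp ℂ 2 μ) x := by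
      refine h1.trans ?_
      rw [Pi.add_apply, h2, Pi.smul_apply, smul_eq_mul]
    rw [hx, h3, ← hnorm _ _ hux hvx, Real.sqrt_sq (norm_nonneg _)]
  · unfold kinetic
    rw [← integral_add ((Lp.memLp (D.grad u)).integrable_norm_pow two_ne_zero)
      ((Lp.memLp (D.grad v)).integrable_norm_pow two_ne_zero)]
    refine integral_congr_ae ?_
    rw [D.grad.map_add, D.grad.map_smul]
    filter_upwards [grad_im_eq_zero D u hu, grad_im_eq_zero D v hv,
      Lp.coeFn_add (D.grad u) (Complex.I • D.grad v), Lp.coeFn_smul Complex.I (D.grad v)]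
      with x hux hvx h1 h2
    rw [h1, Pi.add_apply, h2, Pi.smul_apply]
    simp only [EuclideanSpace.norm_sq_eq, ← Finset.sum_add_distrib]
    refine Finset.sum_congr rfl fun i _ => ?_
    exact hnorm _ _ (hux i) (hvx i)

theorem exists_sqrt_sum_kinetic_le (u : ℕ → D.grad.domain) (n : ℕ) :
    ∃ w : D.grad.domain,
      (∀ᵐ x ∂μ, (w : Lp ℂ 2 μ) x =
        (√(∑ k ∈ Finset.range n, ‖(u k : Lp ℂ 2 μ) x‖ ^ 2) : ℂ)) ∧
      kinetic D w ≤ ∑ k ∈ Finset.range n, kinetic D (u k) := by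
  induction n with
  | zero =>
    refine ⟨0, ?_, ?_⟩
    · filter_upwards [Lp.coeFn_zero ℂ 2 μ] with x hx
      simpa using hx
    · simp [kinetic_eq_norm_sq]
  | succ n ih =>
    obtain ⟨w, hw, hwk⟩ := ih
    -- `u n` may be complex; its modulus has the same density, no more energy, and is real.
    obtain ⟨m, hm, hmk⟩ := exists_modulus_kinetic_le D (u n)
    obtain ⟨w', hw', hwk'⟩ := exists_sqrt_add_kinetic_le D w m
      (by filter_upwards [hw] with x hx; simp [hx]) (by filter_upwards [hm] with x hx; simp [hx])
    refine ⟨w', ?_, ?_⟩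
    · filter_upwards [hw, hm, hw'] with x hx hmx hx'
      rw [hx', hx, hmx, Finset.sum_range_succ, Complex.norm_real, Complex.norm_real, norm_norm,
        Real.norm_of_nonneg (Real.sqrt_nonneg _),
        Real.sq_sqrt (Finset.sum_nonneg fun _ _ => by positivity)]
    · rw [Finset.sum_range_succ]
      linarith

theorem kinetic_smul (c : ℂ) (u : D.grad.domain) : kinetic D (c • u) = ‖c‖ ^ 2 * kinetic D u := by
  rw [kinetic_eq_norm_sq, kinetic_eq_norm_sq, D.grad.map_smul, norm_smul, mul_pow]

/-- Convexity of the kinetic energy in the density. -/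
theorem exists_sqrt_average_kinetic_le (u : ℕ → D.grad.domain) (n : ℕ) {M : ℝ} (hM : 0 ≤ M)
    (hu : ∀ k, kinetic D (u k) ≤ M) :
    ∃ w : D.grad.domain,
      (∀ᵐ x ∂μ, (w : Lp ℂ 2 μ) x =
        (√((∑ k ∈ Finset.range n, ‖(u k : Lp ℂ 2 μ) x‖ ^ 2) / n) : ℂ)) ∧
      kinetic D w ≤ M := by
  obtain ⟨w, hw, hk⟩ := exists_sqrt_sum_kinetic_le D u n
  refine ⟨((1 / √n : ℝ) : ℂ) • w, ?_, ?_⟩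
  · filter_upwards [hw, Lp.coeFn_smul ((1 / √n : ℝ) : ℂ) (w : Lp ℂ 2 μ)] with x hx h1
    refine h1.trans ?_
    rw [Pi.smul_apply, hx, smul_eq_mul, ← Complex.ofReal_mul, Real.sqrt_div' _ (Nat.cast_nonneg n)]
    congr 1
    ring
  · rw [kinetic_smul, Complex.norm_real, Real.norm_of_nonneg (by positivity), div_pow,
      Real.sq_sqrt (Nat.cast_nonneg n), one_pow]
    have h1 : ∑ k ∈ Finset.range n, kinetic D (u k) ≤ n * M := by
      simpa using Finset.sum_le_card_nsmul (Finset.range n) _ M fun k _ => hu k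
    -- For `n = 0` the factor `1 / √n` is `0`, hence the hypothesis `0 ≤ M`.
    rcases Nat.eq_zero_or_pos n with rfl | hn
    · simpa using hM
    · have : (0 : ℝ) < n := by exact_mod_cast hn
      rw [one_div_mul_eq_div, div_le_iff₀ this]
      linarith

end

/-! ### Means over the group -/

section GroupMean

variable {X : Type*} {G : Type*} [Group G] [MeasurableSpace G] [MulAction G X]

/-- The mean of a function over the group. -/
noncomputable def groupMean (ν : Measure G) (f : X → ℝ) (x : X) : ℝ := ∫ g : G, f (g • x) ∂ν

theorem groupMean_smul [MeasurableMul G] (ν : Measure G) [ν.IsMulRightInvariant] (f : X → ℝ)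
    (g : G) (x : X) : groupMean ν f (g • x) = groupMean ν f x := by
  unfold groupMean
  simp_rw [smul_smul]
  exact integral_mul_right_eq_self (fun a : G => f (a • x)) g

theorem groupMean_nonneg (ν : Measure G) {f : X → ℝ} (hf : ∀ x, 0 ≤ f x) (x : X) :
    0 ≤ groupMean ν f x :=
  integral_nonneg fun _ => hf _

variable [MeasurableSpace X] {μ : Measure X} [MeasurableSMul₂ G X] (ν : Measure G)
  [IsProbabilityMeasure ν]

theorem measurable_groupMean {f : X → ℝ} (hf : Measurable f) : Measurable (groupMean ν f) := by
  have h : Measurable fun p : X × G => f (p.2 • p.1) :=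
    hf.comp (measurable_snd.smul measurable_fst)
  exact (h.stronglyMeasurable.integral_prod_right (ν := ν)).measurable

variable [SigmaFinite μ] [SMulInvariantMeasure G X μ]

/-- The shear `(g, x) ↦ (g, g • x)` preserves the product measure because each `g` preserves `μ`;
then project to `X`. -/
theorem measurePreserving_prod_smul :
    MeasurePreserving (fun p : X × G => p.2 • p.1) (μ.prod ν) μ := by
  have h1 : MeasurePreserving (fun p : G × X => (p.1, p.1 • p.2)) (ν.prod μ) (ν.prod μ) :=
    (MeasurePreserving.id ν).skew_product (measurable_fst.smul measurable_snd)
      (ae_of_all _ fun g => (measurePreserving_smul g μ).map_eq)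
  exact (measurePreserving_snd.comp h1).comp Measure.measurePreserving_swap

theorem integrable_prod_smul {f : X → ℝ} (hf : Integrable f μ) :
    Integrable (fun p : X × G => f (p.2 • p.1)) (μ.prod ν) :=
  (measurePreserving_prod_smul ν).integrable_comp_of_integrable hf

theorem integrable_groupMean {f : X → ℝ} (hf : Integrable f μ) :
    Integrable (groupMean ν f) μ :=
  (integrable_prod_smul ν hf).integral_prod_left

theorem integral_groupMean {f : X → ℝ} (hf : Integrable f μ) :
    ∫ x, groupMean ν f x ∂μ = ∫ x, f x ∂μ := by
  have hmp := measurePreserving_prod_smul (μ := μ) ν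
  have h1 := integral_prod _ (integrable_prod_smul ν hf)
  refine h1.symm.trans ?_
  have h2 := integral_map (f := f) hmp.measurable.aemeasurable
    (by rw [hmp.map_eq]; exact hf.aestronglyMeasurable)
  rw [hmp.map_eq] at h2
  exact h2.symm

theorem groupMean_congr_ae {f f' : X → ℝ} (h : f =ᵐ[μ] f') :
    groupMean ν f =ᵐ[μ] groupMean ν f' := by
  have h1 := (measurePreserving_prod_smul (μ := μ) ν).quasiMeasurePreserving.ae_eq_comp h
  filter_upwards [Measure.ae_ae_of_ae_prod h1] with x hx
  exact integral_congr_ae hx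

/-- The mean over the group is the limit of averages over a sequence of group elements. -/
theorem exists_seq_tendsto_groupMean {f : X → ℝ} (hfm : Measurable f) (hf : Integrable f μ) :
    ∃ γ : ℕ → G, ∀ᵐ x ∂μ,
      Tendsto (fun n : ℕ => (∑ k ∈ Finset.range n, f (γ k • x)) / n) atTop
        (𝓝 (groupMean ν f x)) := by
  -- The group elements are drawn independently with law `ν`; for almost every fixed `x` the strong
  -- law applies to `f (γ k • x)`.
  let P : Measure (ℕ → G) := Measure.infinitePi fun _ => ν
  have hx : ∀ᵐ x ∂μ, ∀ᵐ γ ∂P,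
      Tendsto (fun n : ℕ => (∑ k ∈ Finset.range n, f (γ k • x)) / n) atTop
        (𝓝 (groupMean ν f x)) := by
    filter_upwards [(integrable_prod_smul ν hf).prod_right_ae] with x hx
    have hfx : Measurable fun g : G => f (g • x) := hfm.comp (measurable_id.smul_const x)
    have hev : ∀ k : ℕ, MeasurePreserving (fun γ : ℕ → G => γ k) P ν := fun k =>
      measurePreserving_eval_infinitePi (fun _ => ν) k
    have hint : Integrable (fun γ : ℕ → G => f (γ 0 • x)) P :=
      (hev 0).integrable_comp_of_integrable hx
    have hindep := ProbabilityTheory.iIndepFun_infinitePi (P := fun _ : ℕ => ν)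
      (X := fun _ g => f (g • x)) (fun _ => hfx)
    have hlaw := ProbabilityTheory.strong_law_ae_real
      (fun (k : ℕ) (γ : ℕ → G) => f (γ k • x)) hint
      (fun i j hij => hindep.indepFun hij)
      (fun k => ⟨(hfx.comp (measurable_pi_apply k)).aemeasurable,
        (hfx.comp (measurable_pi_apply 0)).aemeasurable, by
          have := fun j : ℕ => Measure.map_map (μ := P) hfx (measurable_pi_apply j)
          simp only [Function.comp_def] at this
          rw [← this k, ← this 0, (hev k).map_eq, (hev 0).map_eq]⟩)
    have hmean : ∫ γ, f (γ 0 • x) ∂P = groupMean ν f x := by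
      have := integral_map (μ := P) (f := fun g : G => f (g • x))
        (measurable_pi_apply 0).aemeasurable hfx.aestronglyMeasurable
      rw [(hev 0).map_eq] at this
      exact this.symm
    rw [hmean] at hlaw
    exact hlaw
  -- Measurability of the convergence set permits exchanging the quantifiers over `x` and `γ`, so
  -- that a single `γ` serves almost every `x`.
  have hmeas : MeasurableSet {p : X × (ℕ → G) |
      Tendsto (fun n : ℕ => (∑ k ∈ Finset.range n, f (p.2 k • p.1)) / n) atTop
        (𝓝 (groupMean ν f p.1))} := by
    refine measurableSet_tendsto_fun (fun n => ?_)
      ((measurable_groupMean ν hfm).comp measurable_fst)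
    refine Measurable.div_const (Finset.measurable_sum _ fun k _ => ?_) _
    exact hfm.comp (((measurable_pi_apply k).comp measurable_snd).smul measurable_fst)
  exact ((Measure.ae_ae_comm hmeas).1 hx).exists

end GroupMean

/-! ### Kinetic energy of the symmetrized density -/

section Kinetic

variable {X : Type*} [MeasurableSpace X] {μ : Measure X} {ι : Type*} [Fintype ι]

theorem measurable_density (u : Lp ℂ 2 μ) : Measurable (density u) :=
  (Lp.stronglyMeasurable u).measurable.norm.pow_const 2

theorem integrable_density (u : Lp ℂ 2 μ) : Integrable (density u) μ :=
  (Lp.memLp u).integrable_norm_pow two_ne_zero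

theorem density_nonneg (u : Lp ℂ 2 μ) (x : X) : 0 ≤ density u x := sq_nonneg _

/-- Symmetrization of the density over the group does not increase the kinetic energy. -/
theorem exists_sqrt_groupMean_kinetic_le {G : Type*} [Group G] [MeasurableSpace G] [MulAction G X]
    [MeasurableSMul₂ G X] (ν : Measure G) [IsProbabilityMeasure ν] [SigmaFinite μ]
    [SMulInvariantMeasure G X μ] (D : WeakGradient μ ι) (hD : KineticInvariant G D)
    (u : D.grad.domain) :
    ∃ w : D.grad.domain,
      (∀ᵐ x ∂μ, (w : Lp ℂ 2 μ) x = (√(groupMean ν (density (u : Lp ℂ 2 μ)) x) : ℂ)) ∧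
      kinetic D w ≤ kinetic D u := by
  set f := density (u : Lp ℂ 2 μ) with hf
  have hfm : Measurable f := measurable_density _
  have hfi : Integrable f μ := integrable_density _
  have hf0 : ∀ x, 0 ≤ f x := density_nonneg _
  have hF0 := groupMean_nonneg ν hf0
  obtain ⟨γ, hγ⟩ := exists_seq_tendsto_groupMean ν hfm hfi
  choose t ht htk using fun k => hD (γ k) u
  choose w hw hwk using fun n => exists_sqrt_average_kinetic_le D t n
    (M := kinetic D u) (integral_nonneg fun _ => sq_nonneg _) (fun k => (htk k).le)
  have hw' : ∀ n, ∀ᵐ x ∂μ, (w n : Lp ℂ 2 μ) x =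
      (√((∑ k ∈ Finset.range n, f (γ k • x)) / n) : ℂ) := by
    intro n
    filter_upwards [hw n, ae_all_iff.2 ht] with x hx htx
    simp only [hx, htx, hf, density]
  have hsq : ∀ r : ℝ, 0 ≤ r → ‖(√r : ℂ)‖ ^ 2 = r := fun r hr => by
    rw [Complex.norm_real, Real.norm_of_nonneg (Real.sqrt_nonneg r), Real.sq_sqrt hr]
  have hmem : MemLp (fun x => ((√(groupMean ν f x) : ℝ) : ℂ)) 2 μ := by
    refine (memLp_two_iff_integrable_sq_norm ?_).2 ?_
    · exact (Complex.measurable_ofReal.comp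
        (measurable_groupMean ν hfm).sqrt).aestronglyMeasurable
    · simp_rw [hsq _ (hF0 _)]
      exact integrable_groupMean ν hfi
  have hv := hmem.coeFn_toLp
  have hvnorm : ‖hmem.toLp‖ ^ 2 = ∫ x, f x ∂μ := by
    rw [norm_sq_eq_integral_norm_sq, ← integral_groupMean ν hfi]
    refine integral_congr_ae ?_
    filter_upwards [hv] with x hx
    rw [hx, hsq _ (hF0 x)]
  -- Equality holds for `n ≥ 1`; the empty average at `n = 0` is zero, so only `≤` is claimed.
  have hwnorm : ∀ n, ‖(w n : Lp ℂ 2 μ)‖ ^ 2 ≤ ∫ x, f x ∂μ := by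
    intro n
    have h1 : ‖(w n : Lp ℂ 2 μ)‖ ^ 2 = ∫ x, (∑ k ∈ Finset.range n, f (γ k • x)) / n ∂μ := by
      rw [norm_sq_eq_integral_norm_sq]
      refine integral_congr_ae ?_
      filter_upwards [hw' n] with x hx
      rw [hx, hsq _ (div_nonneg (Finset.sum_nonneg fun _ _ => hf0 _) (Nat.cast_nonneg n))]
    have h3 : ∀ k, Integrable (fun x => f (γ k • x)) μ := fun k =>
      (measurePreserving_smul (γ k) μ).integrable_comp_of_integrable hfi
    rw [h1, integral_div, integral_finsetSum _ fun k _ => h3 k]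
    have h2 : ∀ k, ∫ x, f (γ k • x) ∂μ = ∫ x, f x ∂μ := fun k =>
      integral_smul_eq_self f
    simp only [h2, Finset.sum_const, Finset.card_range, nsmul_eq_mul]
    rcases Nat.eq_zero_or_pos n with rfl | hn
    · simpa using integral_nonneg hf0
    · have : (n : ℝ) ≠ 0 := by exact_mod_cast hn.ne'
      rw [mul_div_cancel_left₀ _ this]
  have hlim : Tendsto (fun n => (w n : Lp ℂ 2 μ)) atTop (𝓝 hmem.toLp) := by
    refine tendsto_Lp_two_of_ae_tendsto_of_norm_le _ _ ?_ fun n => ?_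
    · filter_upwards [ae_all_iff.2 hw', hv, hγ] with x hx hvx hγx
      simp only [hx, hvx]
      exact (Complex.continuous_ofReal.tendsto _).comp hγx.sqrt
    · exact le_of_sq_le_sq ((hwnorm n).trans hvnorm.ge) (norm_nonneg _)
  obtain ⟨w', hw1, hk⟩ := exists_kinetic_le_of_approx D hmem.toLp (kinetic D u) fun ε hε => by
    obtain ⟨n, hn⟩ := ((tendsto_iff_norm_sub_tendsto_zero.1 hlim).eventually_le_const hε).exists
    exact ⟨w n, hn, hwk n⟩
  exact ⟨w', by rw [hw1]; exact hv, hk⟩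

end Kinetic

/-! ### Splitting of the interaction energy -/

section Interaction

variable {X : Type*} [MeasurableSpace X] {μ : Measure X} {h : X → X → ℝ}

theorem interaction_integrand_congr [SFinite μ] {f f' : X → ℝ} (hf : f =ᵐ[μ] f') :
    (fun p : X × X => f p.1 * h p.1 p.2 * f p.2) =ᵐ[μ.prod μ]
      fun p : X × X => f' p.1 * h p.1 p.2 * f' p.2 := by
  filter_upwards [Measure.quasiMeasurePreserving_fst.ae_eq_comp hf,
    Measure.quasiMeasurePreserving_snd.ae_eq_comp hf] with p h1 h2
  simp only [Function.comp_apply] at h1 h2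
  rw [h1, h2]

theorem interaction_congr_ae [SFinite μ] {f f' : X → ℝ} (hf : f =ᵐ[μ] f') :
    interaction μ h f = interaction μ h f' :=
  integral_congr_ae (interaction_integrand_congr hf)

theorem InteractionConverges.congr_ae [SFinite μ] {f f' : X → ℝ}
    (hc : InteractionConverges μ h f) (hf : f =ᵐ[μ] f') : InteractionConverges μ h f' :=
  Integrable.congr hc (interaction_integrand_congr hf)

/-- For nonnegative `f` and `F`, `f(x) F(y) ≤ (f + F)(x) (f + F)(y)`, so the integrand for `f + F`
dominates. -/
theorem integrable_cross_interaction [SFinite μ] (hhm : Measurable (Function.uncurry h))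
    {f F : X → ℝ}
    (hfm : Measurable f) (hFm : Measurable F) (hf : ∀ x, 0 ≤ f x) (hF : ∀ x, 0 ≤ F x)
    (hc : InteractionConverges μ h (fun x => f x + F x)) :
    Integrable (fun p : X × X => f p.1 * h p.1 p.2 * F p.2) (μ.prod μ) := by
  refine Integrable.mono hc ?_ (ae_of_all _ fun p => ?_)
  · exact (((hfm.comp measurable_fst).mul hhm).mul
      (hFm.comp measurable_snd)).aestronglyMeasurable
  · simp only [norm_mul, Real.norm_eq_abs]
    have h1 := hf p.1
    have h2 := hF p.1
    have h3 := hf p.2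
    have h4 := hF p.2
    rw [abs_of_nonneg h1, abs_of_nonneg h4, abs_of_nonneg (add_nonneg h1 h2),
      abs_of_nonneg (add_nonneg h3 h4)]
    gcongr <;> linarith

variable {G : Type*} [Group G] [MeasurableSpace G] [MulAction G X] [MeasurableSMul₂ G X]
  (ν : Measure G) [IsProbabilityMeasure ν] [SigmaFinite μ] [SMulInvariantMeasure G X μ]

/-- Averaging an integrable kernel over the diagonal action does not change its integral. -/
theorem integral_integral_diagonal_smul {k : X × X → ℝ} (hk : Integrable k (μ.prod μ)) :
    ∫ p, ∫ g : G, k (g • p.1, g • p.2) ∂ν ∂(μ.prod μ) = ∫ p, k p ∂(μ.prod μ) := by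
  have : MeasurableSMul₂ G (X × X) :=
    ⟨(measurable_fst.smul measurable_snd.fst).prodMk (measurable_fst.smul measurable_snd.snd)⟩
  have : SMulInvariantMeasure G (X × X) (μ.prod μ) :=
    ⟨fun g _ hs => ((measurePreserving_smul g μ).prod
      (measurePreserving_smul g μ)).measure_preimage hs.nullMeasurableSet⟩
  exact integral_groupMean ν hk

/-- The interaction energy splits orthogonally into the parts of the mean and of the deviation
from it. -/
theorem interaction_sub_groupMean [MeasurableMul G] [ν.IsMulRightInvariant]
    (hhm : Measurable (Function.uncurry h))
    (hhG : ∀ (g : G) (x y : X), h (g • x) (g • y) = h x y) {f : X → ℝ} (hfm : Measurable f)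
    (hf : ∀ x, 0 ≤ f x) (hc : InteractionConverges μ h f)
    (hcF : InteractionConverges μ h (groupMean ν f))
    (hc' : InteractionConverges μ h (fun x => f x + groupMean ν f x)) :
    interaction μ h (fun x => f x - groupMean ν f x) =
      interaction μ h f - interaction μ h (groupMean ν f) := by
  have hinv := groupMean_smul ν f
  have hF := groupMean_nonneg ν hf
  have hFm := measurable_groupMean ν hfm
  have hmean : ∀ x, ∫ g : G, f (g • x) ∂ν = groupMean ν f x := fun _ => rfl
  generalize groupMean ν f = F at *
  have i1 := integrable_cross_interaction hhm hfm hFm hf hF hc'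
  have i2 := integrable_cross_interaction hhm hFm hfm hF hf
    (by simpa only [add_comm] using hc')
  -- Averaging over the diagonal action leaves `h` and `F` fixed and replaces `f` by `F`.
  have e1 : ∫ p : X × X, f p.1 * h p.1 p.2 * F p.2 ∂(μ.prod μ) = interaction μ h F := by
    rw [← integral_integral_diagonal_smul ν i1]
    simp only [hhG, hinv, integral_mul_const, hmean]
    rfl
  have e2 : ∫ p : X × X, F p.1 * h p.1 p.2 * f p.2 ∂(μ.prod μ) = interaction μ h F := by
    rw [← integral_integral_diagonal_smul ν i2]
    simp only [hhG, hinv, integral_const_mul, hmean]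
    rfl
  have e3 : interaction μ h (fun x => f x - F x) = ∫ p : X × X,
      ((f p.1 * h p.1 p.2 * f p.2 - f p.1 * h p.1 p.2 * F p.2)
        - (F p.1 * h p.1 p.2 * f p.2 - F p.1 * h p.1 p.2 * F p.2)) ∂(μ.prod μ) := by
    unfold interaction
    congr 1 with p
    ring
  have e4 := integral_sub (Integrable.sub hc i1) (i2.sub hcF)
  have e5 := integral_sub hc i1
  have e6 := integral_sub i2 hcF
  simp only [Pi.sub_apply] at e4 e5 e6
  rw [e3, e4, e5, e6, e1, e2]
  unfold interaction
  ring

end Interaction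

end

/-! ### Comparison of the ground state with its symmetrization -/

theorem mainTheorem2
    {X : Type*} [MeasurableSpace X] (μ : Measure X) [SigmaFinite μ]
    {G : Type*} [Group G] [TopologicalSpace G] [IsTopologicalGroup G] [CompactSpace G]
    [MeasurableSpace G] [BorelSpace G]
    (ν : Measure G) [IsProbabilityMeasure ν] [ν.IsMulLeftInvariant] [ν.IsMulRightInvariant]
    [MulAction G X] [MeasurableSMul₂ G X] [SMulInvariantMeasure G X μ]
    {ι : Type*} [Fintype ι] (D : WeakGradient μ ι) (hD : KineticInvariant G D)
    (V : X → ℝ) (hVm : Measurable V) (hVG : ∀ (g : G) (x : X), V (g • x) = V x)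
    (h : X → X → ℝ) (hhm : Measurable (Function.uncurry h))
    (hhG : ∀ (g : G) (x y : X), h (g • x) (g • y) = h x y)
    (I : Submodule ℝ (Lp ℝ 1 μ)) (hIconv : ∀ f ∈ I, InteractionConverges μ h f)
    (hImean : MeanStable ν I)
    (hpos : IsPosDefOnMeanZero h I)
    (b : ℝ) (hb : 0 < b) (N : ℝ)
    (u : D.grad.domain) (hu : IsGroundState D V h b I N u) :
    (∀ g : G, ∀ᵐ x ∂μ, ‖(u : Lp ℂ 2 μ) (g • x)‖ = ‖(u : Lp ℂ 2 μ) x‖) ∧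
    ((∃ c : ℂ, ∀ᵐ x ∂μ, (u : Lp ℂ 2 μ) x = c * (‖(u : Lp ℂ 2 μ) x‖ : ℂ)) →
      ∀ g : G, ∀ᵐ x ∂μ, (u : Lp ℂ 2 μ) (g • x) = (u : Lp ℂ 2 μ) x) := by
  set f := density (u : Lp ℂ 2 μ) with hf
  have hfm : Measurable f := measurable_density _
  have hfi : Integrable f μ := integrable_density _
  have hf0 : ∀ x, 0 ≤ f x := density_nonneg _
  obtain ⟨⟨⟨hVu, f₀, hf₀I, hf₀⟩, hN⟩, hmin⟩ := hu
  obtain ⟨F₀, hF₀I, hF₀⟩ := hImean f₀ hf₀I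
  have hF₀' : F₀ =ᵐ[μ] groupMean ν f := hF₀.trans (groupMean_congr_ae ν hf₀)
  have hFi := integrable_groupMean ν hfi
  have hinv : f =ᵐ[μ] groupMean ν f := by
    by_contra hne
    obtain ⟨w, hw, hwk⟩ := exists_sqrt_groupMean_kinetic_le ν D hD u
    have hwd : density (w : Lp ℂ 2 μ) =ᵐ[μ] groupMean ν f := by
      filter_upwards [hw] with x hx
      rw [density, hx, Complex.norm_real, Real.norm_of_nonneg (Real.sqrt_nonneg _),
        Real.sq_sqrt (groupMean_nonneg ν hf0 x)]
    have hVmean : ∀ x, groupMean ν (fun x => V x * f x) x = V x * groupMean ν f x := fun x => by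
      simp only [groupMean, hVG, integral_const_mul]
    have hVF : (fun x => V x * density (w : Lp ℂ 2 μ) x) =ᵐ[μ]
        groupMean ν (fun x => V x * f x) := by
      filter_upwards [hwd] with x hx
      rw [hx, hVmean]
    have hpot : potential μ V (density (w : Lp ℂ 2 μ)) = potential μ V f :=
      (integral_congr_ae hVF).trans (integral_groupMean ν hVu)
    have hwnorm : ‖(w : Lp ℂ 2 μ)‖ ^ 2 = N := by
      rw [← hN, norm_sq_eq_integral_norm_sq, norm_sq_eq_integral_norm_sq]
      exact (integral_congr_ae hwd).trans (integral_groupMean ν hfi)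
    have hle := hmin ⟨⟨(integrable_groupMean ν hVu).congr hVF.symm, F₀, hF₀I,
      hF₀'.trans hwd.symm⟩, hwnorm⟩
    have hsub : ((f₀ - F₀ : Lp ℝ 1 μ) : X → ℝ) =ᵐ[μ] fun x => f x - groupMean ν f x := by
      filter_upwards [Lp.coeFn_sub f₀ F₀, hf₀, hF₀'] with x h1 h2 h3
      rw [h1, Pi.sub_apply, h2, h3]
    have hadd : ((f₀ + F₀ : Lp ℝ 1 μ) : X → ℝ) =ᵐ[μ] fun x => f x + groupMean ν f x := by
      filter_upwards [Lp.coeFn_add f₀ F₀, hf₀, hF₀'] with x h1 h2 h3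
      rw [h1, Pi.add_apply, h2, h3]
    -- `f - F` has integral zero and is nonzero by assumption, so positive-definiteness contradicts
    -- minimality.
    have hQpos : 0 < interaction μ h (f₀ - F₀ : Lp ℝ 1 μ) := by
      refine hpos _ (I.sub_mem hf₀I hF₀I) ?_ fun h0 => hne ?_
      · rw [integral_congr_ae hsub, integral_sub hfi hFi, integral_groupMean ν hfi, sub_self]
      · rw [h0] at hsub
        filter_upwards [hsub, Lp.coeFn_zero ℝ 1 μ] with x h1 h2
        rw [h2, Pi.zero_apply] at h1
        linarith
    rw [interaction_congr_ae hsub, interaction_sub_groupMean ν hhm hhG hfm hf0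
      ((hIconv _ hf₀I).congr_ae hf₀) ((hIconv _ hF₀I).congr_ae hF₀')
      ((hIconv _ (I.add_mem hf₀I hF₀I)).congr_ae hadd)] at hQpos
    simp only [Set.mem_ofPred_eq, energy, hpot, interaction_congr_ae hwd] at hle
    have := mul_pos hb hQpos
    rw [mul_sub] at this
    linarith
  have hsmul : ∀ g : G, Measure.QuasiMeasurePreserving (fun x : X => g • x) μ μ := fun g =>
    (measurePreserving_smul g μ).quasiMeasurePreserving
  have hmod : ∀ g : G, ∀ᵐ x ∂μ, ‖(u : Lp ℂ 2 μ) (g • x)‖ = ‖(u : Lp ℂ 2 μ) x‖ := by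
    intro g
    filter_upwards [hinv, (hsmul g).ae_eq_comp hinv] with x h1 h2
    simp only [Function.comp_apply] at h2
    rw [groupMean_smul, ← h1] at h2
    exact (sq_eq_sq₀ (norm_nonneg _) (norm_nonneg _)).1 h2
  refine ⟨hmod, ?_⟩
  rintro ⟨c, hc⟩ g
  filter_upwards [hmod g, hc, (hsmul g).ae hc] with x h1 h2 h3
  rw [h3, h1, ← h2]
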